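/- Let $\Gamma=(V,E)$ be a connected graph of bounded valency, with $E\subset V\times V$ symmetric, and let $\mathbb K=\mathbb R$ or $\mathbb C$. For $g:V\to\mathbb K$ let $\nabla g(x,y)=g(y)-g(x)$ for $(x,y)\in E$. For $1\le p<\infty$, the reduced $\ell^p$-cohomology of $\Gamma$ in degree one is $$\overline{\ell^pH}^1(\Gamma)=\bigl(\ell^p(E)\cap\nabla\mathbb K^V\bigr)\big/\,\overline{\nabla \ell^p(V)}^{\,\ell^p(E)} .$$ A function $h:V\to\mathbb K$ is harmonic if, for every vertex $x$, $h(x)$ is the mean of $h$ over the neighbours of $x$. For a real number $d$, $\Gamma$ satisfies the $d$-dimensional isoperimetric profile $\mathrm{IS}_d$ if there is $\kappa>0$ such that $|A|^{1-1/d}\le\kappa\,|\partial A|$ for every non-empty finite set $A\subset V$, where $\partial A$ is the set of edges between $A$ and $V\setminus A$. Suppose that $\Gamma$ satisfies $\mathrm{IS}_d$ and let $1\le q\le p<d/2$. Then: 1. the natural map $\overline{\ell^qH}^1(\Gamma)\to\overline{\ell^pH}^1(\Gamma)$, induced by the inclusion $\ell^q(E)\subset\ell^p(E)$, is injective; 2.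 if $\Gamma$ has no non-constant bounded harmonic function $h$ with $\nabla h\in\ell^p(E)$, then $\overline{\ell^rH}^1(\Gamma)=\{0\}$ for every $r$ with $1\le r<\frac{pd}{d+2p}$; 3. if $\Gamma$ has a non-constant (bounded or not) harmonic function $h$ with $\nabla h\in\ell^p(E)$, then $\overline{\ell^pH}^1(\Gamma)\ne\{0\}$. -/

import Mathlib

open scoped ENNReal

noncomputable section

namespace SimpleGraph

variable {V : Type*} (G : SimpleGraph V)

/-- The gradient of a function on the vertices: `∇g(x, y) = g(y) - g(x)` on every oriented edge
`(x, y)` (the darts of `G` are the ordered pairs of adjacent vertices). -/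
def grad (𝕜 : Type*) [RCLike 𝕜] : (V → 𝕜) →ₗ[𝕜] (G.Dart → 𝕜) where
  toFun g a := g a.snd - g a.fst
  map_add' g h := by
    funext a
    simp only [Pi.add_apply]
    ring
  map_smul' c g := by
    funext a
    simp only [Pi.smul_apply, smul_eq_mul, RingHom.id_apply]
    ring

/-- `ℓ^p` functions on the oriented edges. -/
abbrev EdgeLp (𝕜 : Type*) [RCLike 𝕜] (p : ℝ≥0∞) : Type _ :=
  lp (fun _ : G.Dart => 𝕜) p

/-- `ℓ^p(E) ∩ ∇𝕜^V`: the `ℓ^p` functions on the edges which are gradients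
(in particular they are antisymmetric). -/
def lpGradients (𝕜 : Type*) [RCLike 𝕜] (p : ℝ≥0∞) : Submodule 𝕜 (G.EdgeLp 𝕜 p) where
  carrier := {ω | ∃ g : V → 𝕜, ∀ a : G.Dart, ω a = G.grad 𝕜 g a}
  zero_mem' := ⟨0, fun a => by simp⟩
  add_mem' := by
    rintro ω η ⟨g, hg⟩ ⟨h, hh⟩
    exact ⟨g + h, fun a => by simp [hg a, hh a]⟩
  smul_mem' := by
    rintro c ω ⟨g, hg⟩
    exact ⟨c • g, fun a => by simp [hg a]⟩

/-- `∇ℓ^p(V)`: the gradients of `ℓ^p` functions on the vertices, as a subspace of `ℓ^p(E)`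
(when the valency is bounded, the gradient maps `ℓ^p(V)` into `ℓ^p(E)`). -/
def gradOfLp (𝕜 : Type*) [RCLike 𝕜] (p : ℝ≥0∞) : Submodule 𝕜 (G.EdgeLp 𝕜 p) where
  carrier := {ω | ∃ g : V → 𝕜, Memℓp g p ∧ ∀ a : G.Dart, ω a = G.grad 𝕜 g a}
  zero_mem' := ⟨0, zero_memℓp, fun a => by simp⟩
  add_mem' := by
    rintro ω η ⟨g, hgp, hg⟩ ⟨h, hhp, hh⟩
    exact ⟨g + h, hgp.add hhp, fun a => by simp [hg a, hh a]⟩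
  smul_mem' := by
    rintro c ω ⟨g, hgp, hg⟩
    exact ⟨c • g, hgp.const_smul c, fun a => by simp [hg a]⟩

/-- The closure of `∇ℓ^p(V)` in `ℓ^p(E)`, viewed as a subspace of `ℓ^p(E) ∩ ∇𝕜^V`. -/
def closureGradOfLp (𝕜 : Type*) [RCLike 𝕜] (p : ℝ≥0∞) [Fact (1 ≤ p)] :
    Submodule 𝕜 (G.lpGradients 𝕜 p) :=
  (G.gradOfLp 𝕜 p).topologicalClosure.comap (G.lpGradients 𝕜 p).subtype

/-- The reduced `ℓ^p`-cohomology in degree one: the quotient of `ℓ^p(E) ∩ ∇𝕜^V` by the closure of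
`∇ℓ^p(V)` in `ℓ^p(E)`. -/
abbrev ReducedLpH1 (𝕜 : Type*) [RCLike 𝕜] (p : ℝ≥0∞) [Fact (1 ≤ p)] : Type _ :=
  G.lpGradients 𝕜 p ⧸ G.closureGradOfLp 𝕜 p

/-- The inclusion of `ℓ^q(E)` in `ℓ^p(E)` for `q ≤ p` does not increase the norm. -/
theorem norm_linearMapOfLE_le {ι 𝕜 : Type*} [RCLike 𝕜] {q p : ℝ≥0∞}
    [hq : Fact (1 ≤ q)] [hp : Fact (1 ≤ p)] (h : q ≤ p) (f : lp (fun _ : ι => 𝕜) q) :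
    ‖lp.linearMapOfLE 𝕜 (fun _ : ι => 𝕜) h f‖ ≤ ‖f‖ := by
  have hq0 : q ≠ 0 := (zero_lt_one.trans_le hq.out).ne'
  have hap : ∀ i, ‖f i‖ ≤ ‖f‖ := fun i => lp.norm_apply_le_norm hq0 f i
  rcases eq_or_ne p ∞ with rfl | hpt
  · exact lp.norm_le_of_forall_le (norm_nonneg f) hap
  have hqt : q ≠ ∞ := ne_top_of_le_ne_top hpt h
  have hqr : 0 < q.toReal := ENNReal.toReal_pos hq0 hqt
  have hle : q.toReal ≤ p.toReal := ENNReal.toReal_mono hpt h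
  have hpr : 0 < p.toReal := hqr.trans_le hle
  refine lp.norm_le_of_forall_sum_le hpr (norm_nonneg f) fun s => ?_
  have hsplit : ∀ {t : ℝ}, 0 ≤ t →
      t ^ p.toReal = t ^ q.toReal * t ^ (p.toReal - q.toReal) := by
    intro t ht
    rw [← Real.rpow_add_of_nonneg ht hqr.le (sub_nonneg.2 hle)]
    congr 1
    ring
  calc ∑ i ∈ s, ‖f i‖ ^ p.toReal
      ≤ ∑ i ∈ s, ‖f i‖ ^ q.toReal * ‖f‖ ^ (p.toReal - q.toReal) := by
        refine Finset.sum_le_sum fun i _ => ?_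
        rw [hsplit (norm_nonneg (f i))]
        exact mul_le_mul_of_nonneg_left
          (Real.rpow_le_rpow (norm_nonneg _) (hap i) (sub_nonneg.2 hle))
          (Real.rpow_nonneg (norm_nonneg _) _)
    _ = (∑ i ∈ s, ‖f i‖ ^ q.toReal) * ‖f‖ ^ (p.toReal - q.toReal) := by
        rw [Finset.sum_mul]
    _ ≤ ‖f‖ ^ q.toReal * ‖f‖ ^ (p.toReal - q.toReal) :=
        mul_le_mul_of_nonneg_right (lp.sum_rpow_le_norm_rpow hqr f s)
          (Real.rpow_nonneg (norm_nonneg _) _)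
    _ = ‖f‖ ^ p.toReal := (hsplit (norm_nonneg f)).symm

theorem continuous_linearMapOfLE {ι 𝕜 : Type*} [RCLike 𝕜] {q p : ℝ≥0∞}
    [Fact (1 ≤ q)] [Fact (1 ≤ p)] (h : q ≤ p) :
    Continuous (lp.linearMapOfLE 𝕜 (fun _ : ι => 𝕜) h) :=
  AddMonoidHomClass.continuous_of_bound (lp.linearMapOfLE 𝕜 (fun _ : ι => 𝕜) h) 1
    fun f => by simpa using norm_linearMapOfLE_le h f

/-- The inclusion of `ℓ^q(E) ∩ ∇𝕜^V` in `ℓ^p(E) ∩ ∇𝕜^V` for `q ≤ p`. -/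
def lpGradientsInclusion (𝕜 : Type*) [RCLike 𝕜] {q p : ℝ≥0∞} (h : q ≤ p) :
    G.lpGradients 𝕜 q →ₗ[𝕜] G.lpGradients 𝕜 p :=
  (lp.linearMapOfLE 𝕜 (fun _ : G.Dart => 𝕜) h).restrict fun _ hω => hω

theorem closureGradOfLp_le_comap (𝕜 : Type*) [RCLike 𝕜] {q p : ℝ≥0∞}
    [Fact (1 ≤ q)] [Fact (1 ≤ p)] (h : q ≤ p) :
    G.closureGradOfLp 𝕜 q ≤ (G.closureGradOfLp 𝕜 p).comap (G.lpGradientsInclusion 𝕜 h) := by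
  intro ω hω
  have hmaps : Set.MapsTo (lp.linearMapOfLE 𝕜 (fun _ : G.Dart => 𝕜) h)
      (G.gradOfLp 𝕜 q : Set (G.EdgeLp 𝕜 q)) (G.gradOfLp 𝕜 p : Set (G.EdgeLp 𝕜 p)) := by
    rintro η ⟨g, hg, hη⟩
    exact ⟨g, hg.of_exponent_ge h, hη⟩
  exact hmaps.closure (continuous_linearMapOfLE h) hω

/-- The natural map from the reduced `ℓ^q`-cohomology to the reduced `ℓ^p`-cohomology in degree
one, for `q ≤ p`: the class of `∇g` is sent to the class of `∇g`. -/
def reducedLpH1Map (𝕜 : Type*) [RCLike 𝕜] {q p : ℝ≥0∞} [Fact (1 ≤ q)] [Fact (1 ≤ p)]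
    (h : q ≤ p) : G.ReducedLpH1 𝕜 q →ₗ[𝕜] G.ReducedLpH1 𝕜 p :=
  Submodule.mapQ (G.closureGradOfLp 𝕜 q) (G.closureGradOfLp 𝕜 p) (G.lpGradientsInclusion 𝕜 h)
    (G.closureGradOfLp_le_comap 𝕜 h)

/-- The edges from `A` to its complement, each oriented from `A` to the complement. -/
def edgeBoundary (A : Finset V) : Set G.Dart :=
  {a | a.fst ∈ A ∧ a.snd ∉ A}

/-- In a locally finite graph `edgeBoundary` is finite, so its `ncard` is its true cardinality. -/
theorem finite_edgeBoundary [G.LocallyFinite] (A : Finset V) : (G.edgeBoundary A).Finite := by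
  classical
  have hfin : (⋃ x ∈ (A : Set V), (fun y => (x, y)) '' (G.neighborSet x)).Finite :=
    A.finite_toSet.biUnion fun x _ => (Set.toFinite (G.neighborSet x)).image _
  refine Set.Finite.of_finite_image (f := fun a : G.Dart => a.toProd) (hfin.subset ?_)
    (SimpleGraph.Dart.toProd_injective.injOn)
  rintro _ ⟨a, ⟨ha, -⟩, rfl⟩
  exact Set.mem_biUnion (Finset.mem_coe.2 ha) ⟨a.snd, a.adj, rfl⟩

/-- The isoperimetric profile `IS_F`: there is `κ > 0` with `F(|A|) ≤ κ |∂A|` for every non-empty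
finite set of vertices `A`. -/
def HasIsoperimetricProfile (F : ℝ → ℝ) : Prop :=
  ∃ κ : ℝ, 0 < κ ∧ ∀ A : Finset V, A.Nonempty → F A.card ≤ κ * (G.edgeBoundary A).ncard

/-- The `d`-dimensional isoperimetric profile `IS_d`, given by `F(t) = t^(1 - 1/d)`. -/
def HasIS (d : ℝ) : Prop :=
  G.HasIsoperimetricProfile fun t => t ^ (1 - 1 / d)

/-- The simple random walk operator: `(P g)(x)` is the mean of `g` over the neighbours of `x`. -/
def walkOp [G.LocallyFinite] {𝕜 : Type*} [RCLike 𝕜] (g : V → 𝕜) (x : V) : 𝕜 :=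
  (∑ y ∈ G.neighborFinset x, g y) / (G.degree x : 𝕜)

/-- Harmonic functions for the simple random walk: `P h = h`. -/
def IsHarmonic [G.LocallyFinite] {𝕜 : Type*} [RCLike 𝕜] (h : V → 𝕜) : Prop :=
  ∀ x, G.walkOp h x = h x

end SimpleGraph

end

/-!
Let `P` be the simple random walk operator. Everything rests on an a priori bound
(`green_estimate_norm`): if `1 < m < d/2` and `1/s = 1/m - 2/d`, a finitely supported function `u`
satisfies `‖u‖_s ≤ C ‖(I - P) u‖_m`. It is obtained by testing `(I - P) |u| ≤ |(I - P) u|` against a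
power of `|u|` and applying the `ℓ^1` Sobolev inequality `sobolev_one`, a form of `IS_d`, to another
power of `|u|` (`green_estimate`).

*Triviality of a class.* Since `(I - P) f` is controlled by `∇f`, the bound shows that finitely
supported functions whose gradients converge in `ℓ^p` are bounded in some `ℓ^s`, so that the limit
is the gradient of a function vanishing at infinity. Conversely, if `g` vanishes at infinity and
`∇g ∈ ℓ^p`, truncating `g` at small heights and dominated convergence show that `∇g` is a limit of
gradients of finitely supported functions. Hence, for `p < d/2`, the class of `∇g` is trivial if and
only if `g` is constant at infinity (`mem_closure_gradOfLp_iff`). This condition does not depend on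
`p`, which gives injectivity; by the maximum principle a non-constant harmonic function is not
constant at infinity, which gives non-vanishing.

*Vanishing.* Let `∇g ∈ ℓ^r` with `1/r > 1/p + 2/d`. Truncating at large heights, one may assume that
`g` is bounded. With `1/m = 1/p + 2/d`, the function `(I - P) g` is in `ℓ^m`, and solving Dirichlet
problems on finite sets with the a priori bound gives `u ∈ ℓ^p` with `(I - P) u = (I - P) g`
(`exists_sub_walkOp_eq`). Then `g - u` is harmonic, bounded, with gradient in `ℓ^p`. If it is
constant, then `g` is constant at infinity, and the class of `∇g` in `ℓ^r`-cohomology is trivial.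
-/

noncomputable section

namespace SimpleGraph

/-! ### The Sobolev inequality in `ℓ^1` -/

section Sobolev

variable {V : Type*} {G : SimpleGraph V}

theorem ncard_edgeBoundary_le [G.LocallyFinite] [DecidableEq V] (A : Finset V) :
    (G.edgeBoundary A).ncard ≤
      ∑ x ∈ A, ((G.neighborFinset x).filter fun y => y ∉ A).card := by
  classical
  rw [← Finset.card_sigma, ← Set.ncard_coe_finset]
  refine Set.ncard_le_ncard_of_injOn (fun a : G.Dart => (⟨a.fst, a.snd⟩ : Σ _ : V, V))
    (fun a ha => ?_) (fun a _ b _ hab => ?_) (Finset.finite_toSet _)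
  · simpa [edgeBoundary, a.adj] using ha
  · have h1 : a.fst = b.fst := congrArg Sigma.fst hab
    have h2 : a.snd = b.snd := by simpa using (Sigma.mk.inj hab).2
    exact Dart.toProd_injective (Prod.ext h1 h2)

/-- The coarea form of the isoperimetric inequality: peeling off the lowest level of `v` reduces
the inequality to the indicator functions of finite sets, where it is `IS_d`. -/
theorem sobolev_one [G.LocallyFinite] {d κ : ℝ} (hd : 1 < d) (hκ : 0 < κ)
    (hIS : ∀ A : Finset V, A.Nonempty →
      (A.card : ℝ) ^ (1 - 1 / d) ≤ κ * (G.edgeBoundary A).ncard)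
    (A : Finset V) : ∀ v : V → ℝ, (∀ x, 0 ≤ v x) → (∀ x, x ∉ A → v x = 0) →
    (∑ x ∈ A, v x ^ (d / (d - 1))) ^ ((d - 1) / d) ≤
      κ * ∑ x ∈ A, ∑ y ∈ G.neighborFinset x, max (v x - v y) 0 := by
  classical
  have hd0 : 0 < d := by linarith
  have hd1 : 0 < d - 1 := by linarith
  have hq : 1 ≤ d / (d - 1) := by rw [le_div_iff₀ hd1]; linarith
  have hq0 : d / (d - 1) ≠ 0 := by positivity
  induction A using Finset.strongInduction with
  | H A ih =>
    intro v hv hvA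
    rcases A.eq_empty_or_nonempty with rfl | hA
    · rw [Finset.sum_empty, Finset.sum_empty, Real.zero_rpow (by positivity), mul_zero]
    obtain ⟨x₀, hx₀, hmin⟩ := A.exists_min_image v hA
    -- `v` is at least `m` on `A`, and `u = v - m` is supported in the smaller set `A \ {x₀}`
    set m := v x₀ with hm
    have hm0 : 0 ≤ m := hv x₀
    set u : V → ℝ := fun x => if x ∈ A then v x - m else 0 with hu
    have hu0 : ∀ x, 0 ≤ u x := fun x => by
      by_cases h : x ∈ A
      · simpa [hu, h] using hmin x h
      · simp [hu, h]
    have hux₀ : u x₀ = 0 := by simp [hu, hx₀, hm]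
    have huA : ∀ x, x ∉ A.erase x₀ → u x = 0 := fun x hx => by
      by_cases h : x = x₀
      · rw [h, hux₀]
      · have : x ∉ A := fun h' => hx (Finset.mem_erase.2 ⟨h, h'⟩)
        simp [hu, this]
    have key := ih (A.erase x₀) (Finset.erase_ssubset hx₀) u hu0 huA
    have e1 : ∑ x ∈ A.erase x₀, u x ^ (d / (d - 1)) = ∑ x ∈ A, u x ^ (d / (d - 1)) := by
      rw [← Finset.add_sum_erase A _ hx₀, hux₀, Real.zero_rpow hq0, zero_add]
    have e2 : ∑ x ∈ A.erase x₀, ∑ y ∈ G.neighborFinset x, max (u x - u y) 0 =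
        ∑ x ∈ A, ∑ y ∈ G.neighborFinset x, max (u x - u y) 0 := by
      rw [← Finset.add_sum_erase A _ hx₀, hux₀]
      rw [Finset.sum_eq_zero (s := G.neighborFinset x₀), zero_add]
      intro y _
      exact max_eq_right (by linarith [hu0 y])
    rw [e1, e2] at key
    have hexp : 1 / (d / (d - 1)) = (d - 1) / d := by rw [one_div_div]
    have mink := Real.Lp_add_le_of_nonneg (s := A) (f := fun _ => m) (g := u) hq
      (fun _ _ => hm0) (fun x _ => hu0 x)
    rw [hexp] at mink
    have e3 : ∑ x ∈ A, v x ^ (d / (d - 1)) = ∑ x ∈ A, (m + u x) ^ (d / (d - 1)) :=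
      Finset.sum_congr rfl fun x hx => by simp [hu, hx]
    have e4 : (∑ x ∈ A, m ^ (d / (d - 1))) ^ ((d - 1) / d) =
        m * (A.card : ℝ) ^ (1 - 1 / d) := by
      rw [Finset.sum_const, nsmul_eq_mul, Real.mul_rpow (by positivity) (by positivity),
        ← Real.rpow_mul hm0, mul_comm]
      congr 1
      · rw [show d / (d - 1) * ((d - 1) / d) = 1 by field_simp, Real.rpow_one]
      · congr 1; field_simp
    have e5 : ∑ x ∈ A, ∑ y ∈ G.neighborFinset x, max (v x - v y) 0 =
        m * ∑ x ∈ A, (((G.neighborFinset x).filter fun y => y ∉ A).card : ℝ) +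
        ∑ x ∈ A, ∑ y ∈ G.neighborFinset x, max (u x - u y) 0 := by
      rw [Finset.mul_sum, ← Finset.sum_add_distrib]
      refine Finset.sum_congr rfl fun x hx => ?_
      rw [Finset.card_filter, Nat.cast_sum, Finset.mul_sum, ← Finset.sum_add_distrib]
      refine Finset.sum_congr rfl fun y _ => ?_
      by_cases hy : y ∈ A
      · simp [hu, hx, hy]
      · have : m ≤ v x := hmin x hx
        simp [hu, hx, hy, hvA y hy, this, hv x]
    have hbd : (A.card : ℝ) ^ (1 - 1 / d) ≤
        κ * ∑ x ∈ A, (((G.neighborFinset x).filter fun y => y ∉ A).card : ℝ) := by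
      refine (hIS A hA).trans (mul_le_mul_of_nonneg_left ?_ hκ.le)
      exact_mod_cast ncard_edgeBoundary_le A
    rw [e3, e5]
    rw [e4] at mink
    nlinarith [mul_le_mul_of_nonneg_left hbd hm0]

end Sobolev

/-! ### The Green estimate -/

section Green

variable {V : Type*} {G : SimpleGraph V}

/-- The pointwise inequality behind the Green estimate. By homogeneity one may take `a = 1`, where
it follows from `1 - t ^ γ ≤ γ (1 - t)` and `min θ 1 * (1 - t) ≤ 1 - t ^ θ`. -/
theorem rpow_sub_rpow_sq_le {γ θ : ℝ} (hγ : 1 ≤ γ) (hθ : 0 < θ) {a b : ℝ} (hb : 0 ≤ b)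
    (hab : b ≤ a) :
    (a ^ γ - b ^ γ) ^ 2 ≤
      γ ^ 2 / min θ 1 * (a ^ (2 * γ - 1 - θ) * ((a - b) * (a ^ θ - b ^ θ))) := by
  rcases (hb.trans hab).eq_or_lt with ha | ha
  · have hb' : b = 0 := by linarith
    subst hb'; rw [← ha]; simp
  have hmin : 0 < min θ 1 := lt_min hθ one_pos
  obtain ⟨t, rfl⟩ : ∃ t, b = a * t := ⟨b / a, by field_simp⟩
  have ht0 : 0 ≤ t := by
    by_contra h
    nlinarith
  have ht1 : t ≤ 1 := by
    by_contra h
    nlinarith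
  have h1 : 1 - t ^ γ ≤ γ * (1 - t) := by
    have := one_add_mul_self_le_rpow_one_add (s := t - 1) (by linarith) hγ
    rw [add_sub_cancel] at this
    linarith
  have h1' : 0 ≤ 1 - t ^ γ := sub_nonneg.2 (Real.rpow_le_one ht0 ht1 (by linarith))
  have h2 : min θ 1 * (1 - t) ≤ 1 - t ^ θ := by
    rcases le_total θ 1 with h | h
    · rw [min_eq_left h]
      have := rpow_one_add_le_one_add_mul_self (s := t - 1) (by linarith) hθ.le h
      rw [add_sub_cancel] at this
      linarith
    · rw [min_eq_right h]
      have := Real.rpow_le_rpow_of_exponent_ge' ht0 ht1 zero_le_one h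
      rw [Real.rpow_one] at this
      linarith
  rw [Real.mul_rpow ha.le ht0, Real.mul_rpow ha.le ht0]
  have e : a ^ (2 * γ - 1 - θ) * ((a - a * t) * (a ^ θ - a ^ θ * t ^ θ)) =
      (a ^ γ) ^ 2 * ((1 - t) * (1 - t ^ θ)) := by
    have : (a ^ γ) ^ 2 = a ^ (2 * γ - 1 - θ) * (a * a ^ θ) := by
      rw [← Real.rpow_natCast, ← Real.rpow_mul ha.le]
      nth_rewrite 3 [← Real.rpow_one a]
      rw [← Real.rpow_add ha, ← Real.rpow_add ha]
      congr 1; push_cast; ring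
    rw [this]; ring
  rw [e]
  have h3 : (1 - t ^ γ) ^ 2 ≤ γ ^ 2 / min θ 1 * ((1 - t) * (1 - t ^ θ)) := by
    rw [div_mul_eq_mul_div, le_div_iff₀ hmin]
    calc (1 - t ^ γ) ^ 2 * min θ 1 ≤ (γ * (1 - t)) ^ 2 * min θ 1 := by gcongr
      _ = γ ^ 2 * ((1 - t) * (min θ 1 * (1 - t))) := by ring
      _ ≤ γ ^ 2 * ((1 - t) * (1 - t ^ θ)) := by
        have : 0 ≤ 1 - t := by linarith
        gcongr
  calc (a ^ γ - a ^ γ * t ^ γ) ^ 2 = (a ^ γ) ^ 2 * (1 - t ^ γ) ^ 2 := by ring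
    _ ≤ (a ^ γ) ^ 2 * (γ ^ 2 / min θ 1 * ((1 - t) * (1 - t ^ θ))) := by gcongr
    _ = _ := by ring

theorem sum_neighborFinset_eq_of_support [G.LocallyFinite] [DecidableEq V] [DecidableRel G.Adj]
    (A : Finset V)
    (e : V → V → ℝ) (he : ∀ x y, y ∉ A → e x y = 0) :
    ∑ x ∈ A, ∑ y ∈ G.neighborFinset x, e x y =
      ∑ x ∈ A, ∑ y ∈ A, if G.Adj x y then e x y else 0 := by
  refine Finset.sum_congr rfl fun x _ => ?_
  rw [← Finset.sum_filter]
  refine (Finset.sum_subset_zero_on_sdiff ?_ ?_ fun _ _ => rfl).symm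
  · intro y hy
    simpa using (Finset.mem_filter.1 hy).2
  · intro y hy
    rw [Finset.mem_sdiff, mem_neighborFinset, Finset.mem_filter, not_and'] at hy
    exact he x y (hy.2 hy.1)

/-- Green's formula for a function `w` with support in `A`; the right side runs over the edges
oriented in the direction in which `w` decreases. -/
theorem sum_mul_sub_eq_energy [G.LocallyFinite] (A : Finset V) {w φ : V → ℝ}
    (hw : ∀ x, 0 ≤ w x) (hwA : ∀ x, x ∉ A → w x = 0) (hφA : ∀ x, x ∉ A → φ x = 0) :
    ∑ x ∈ A, ∑ y ∈ G.neighborFinset x, φ x * (w x - w y) =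
      ∑ x ∈ A, ∑ y ∈ G.neighborFinset x, max (w x - w y) 0 * (φ x - φ y) := by
  classical
  have key : ∑ x ∈ A, ∑ y ∈ G.neighborFinset x, φ x * max (w y - w x) 0 =
      ∑ x ∈ A, ∑ y ∈ G.neighborFinset x, φ y * max (w x - w y) 0 := by
    rw [sum_neighborFinset_eq_of_support A (fun x y => φ x * max (w y - w x) 0),
      sum_neighborFinset_eq_of_support A (fun x y => φ y * max (w x - w y) 0), Finset.sum_comm]
    · simp only [G.adj_comm]
    · intro x y hy
      rw [hφA y hy, zero_mul]
    · intro x y hy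
      rw [hwA y hy, max_eq_right (by linarith [hw x]), mul_zero]
  have e : ∀ x y, φ x * (w x - w y) = φ x * max (w x - w y) 0 - φ x * max (w y - w x) 0 := by
    intro x y
    rcases le_total (w x) (w y) with h | h
    · rw [max_eq_right (by linarith), max_eq_left (by linarith)]; ring
    · rw [max_eq_left (by linarith), max_eq_right (by linarith)]; ring
  simp only [e, Finset.sum_sub_distrib, key, mul_sub]
  congr 1 <;> exact Finset.sum_congr rfl fun x _ => Finset.sum_congr rfl fun y _ => mul_comm _ _

theorem degree_mul_walkOp [G.LocallyFinite] {𝕜 : Type*} [RCLike 𝕜] (g : V → 𝕜) (x : V) :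
    (G.degree x : 𝕜) * G.walkOp g x = ∑ y ∈ G.neighborFinset x, g y := by
  by_cases h : G.degree x = 0
  · have : G.neighborFinset x = ∅ := by rwa [← Finset.card_eq_zero, card_neighborFinset_eq_degree]
    simp [h, this]
  · rw [walkOp, mul_div_cancel₀]
    exact_mod_cast h

theorem sum_sub_eq_degree_mul [G.LocallyFinite] {𝕜 : Type*} [RCLike 𝕜] (g : V → 𝕜) (x : V) :
    ∑ y ∈ G.neighborFinset x, (g x - g y) = (G.degree x : 𝕜) * (g x - G.walkOp g x) := by
  rw [mul_sub, degree_mul_walkOp, Finset.sum_sub_distrib, Finset.sum_const,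
    card_neighborFinset_eq_degree, nsmul_eq_mul]

/-- The Green estimate: a finitely supported nonnegative `w` with `(I - P) w ≤ F` on its support is
bounded in `ℓ^s` by the norm of `F` in `ℓ^m`, where `1/s = 1/m - 2/d`. It follows by testing
`(I - P) w ≤ F` against the power `w ^ (s (m - 1) / m)` and applying the `ℓ^1` Sobolev inequality to
the power `w ^ (s (d - 1) / d)`. -/
theorem green_estimate [G.LocallyFinite] {N : ℕ} (hN : ∀ x, G.degree x ≤ N)
    {d : ℝ} (hIS : G.HasIS d) {m s : ℝ} (hm : 1 < m) (hmd : m < d / 2)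
    (hs : 1 / s = 1 / m - 2 / d) :
    ∃ C : ℝ, 0 ≤ C ∧ ∀ (A : Finset V) (w F : V → ℝ), (∀ x, 0 ≤ w x) → (∀ x, x ∉ A → w x = 0) →
      (∀ x, 0 ≤ F x) → (∀ x ∈ A, w x ≤ F x + G.walkOp w x) →
      (∑ x ∈ A, w x ^ s) ^ (1 / s) ≤ C * (∑ x ∈ A, F x ^ m) ^ (1 / m) := by
  classical
  obtain ⟨κ, hκ, hIS⟩ := hIS
  have hd : 2 < d := by linarith
  have hd0 : 0 < d := by linarith
  have hm0 : 0 < m := by linarith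
  have hsinv : 0 < 1 / s := by
    rw [hs, sub_pos, div_lt_div_iff₀ hd0 hm0]; linarith
  have hs0 : 0 < s := one_div_pos.1 hsinv
  have hs' : s = m * d / (d - 2 * m) := by
    have : d - 2 * m ≠ 0 := by linarith
    rw [eq_div_iff this]
    field_simp at hs
    linarith
  have hdm : 0 < d - 2 * m := by linarith
  set θ := s * (m - 1) / m with hθ
  set γ := s * (d - 1) / d with hγ
  have hθ0 : 0 < θ := by
    have : 0 < m - 1 := by linarith
    positivity
  have hγ1 : 1 ≤ γ := by
    rw [hγ, hs', le_div_iff₀ hd0, div_mul_eq_mul_div, le_div_iff₀ hdm]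
    have : d - 2 * m ≤ m * (d - 1) := by nlinarith
    nlinarith
  have hexp : 2 * γ - 1 - θ = s := by
    rw [hγ, hθ, hs']
    field_simp
    ring
  set K := γ ^ 2 / min θ 1 with hK
  have hK0 : 0 ≤ K := by
    have : 0 < min θ 1 := lt_min hθ0 one_pos
    positivity
  refine ⟨κ ^ 2 * K * N * N, by positivity, fun A w F hw hwA hF hle => ?_⟩
  set X := ∑ x ∈ A, w x ^ s with hX
  set Y := ∑ x ∈ A, F x ^ m with hY
  have hX0 : 0 ≤ X := Finset.sum_nonneg fun x _ => Real.rpow_nonneg (hw x) _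
  have hY0 : 0 ≤ Y := Finset.sum_nonneg fun x _ => Real.rpow_nonneg (hF x) _
  rcases hX0.eq_or_lt with hX' | hXpos
  · rw [← hX', Real.zero_rpow hsinv.ne']
    positivity
  -- the energy of the pair `w`, `w ^ θ`
  set E := ∑ x ∈ A, ∑ y ∈ G.neighborFinset x, max (w x - w y) 0 * (w x ^ θ - w y ^ θ) with hE
  have hEle : E ≤ N * (X ^ (1 - 1 / m) * Y ^ (1 / m)) := by
    rw [hE, ← sum_mul_sub_eq_energy A hw hwA
      (fun x hx => by rw [hwA x hx, Real.zero_rpow hθ0.ne'])]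
    have hstep : ∀ x ∈ A, ∑ y ∈ G.neighborFinset x, w x ^ θ * (w x - w y) ≤
        N * (w x ^ θ * F x) := fun x hx => by
      rw [← Finset.mul_sum, sum_sub_eq_degree_mul]
      have h1 : w x - G.walkOp w x ≤ F x := by linarith [hle x hx]
      have h2 : (G.degree x : ℝ) ≤ N := by exact_mod_cast hN x
      have h3 : 0 ≤ w x ^ θ := Real.rpow_nonneg (hw x) _
      calc w x ^ θ * (G.degree x * (w x - G.walkOp w x))
          ≤ w x ^ θ * (G.degree x * F x) := by gcongr
        _ ≤ w x ^ θ * (N * F x) := by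
          have := hF x
          gcongr
        _ = _ := by ring
    refine (Finset.sum_le_sum hstep).trans ?_
    rw [← Finset.mul_sum]
    refine mul_le_mul_of_nonneg_left ?_ (Nat.cast_nonneg N)
    have hconj : Real.HolderConjugate (Real.conjExponent m) m :=
      (Real.HolderConjugate.conjExponent hm).symm
    refine (Real.inner_le_Lp_mul_Lq_of_nonneg A hconj
      (fun x _ => Real.rpow_nonneg (hw x) _) (fun x _ => hF x)).trans (le_of_eq ?_)
    have hm1 : m - 1 ≠ 0 := by linarith
    congr 2
    · refine Finset.sum_congr rfl fun x _ => ?_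
      rw [← Real.rpow_mul (hw x)]
      congr 1
      rw [hθ, Real.conjExponent]; field_simp
    · rw [Real.conjExponent]; field_simp
  have hsob := sobolev_one (by linarith) hκ hIS A (fun x => w x ^ γ)
    (fun x => Real.rpow_nonneg (hw x) _)
    (fun x hx => by rw [hwA x hx, Real.zero_rpow (by linarith)])
  have hXeq : ∑ x ∈ A, (w x ^ γ) ^ (d / (d - 1)) = X := by
    refine Finset.sum_congr rfl fun x _ => ?_
    rw [← Real.rpow_mul (hw x)]
    congr 1
    have : d - 1 ≠ 0 := by linarith
    rw [hγ]; field_simp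
  rw [hXeq] at hsob
  set D := ∑ x ∈ A, ∑ y ∈ G.neighborFinset x, max (w x ^ γ - w y ^ γ) 0 with hD
  have hterm : ∀ x y, max (w x ^ γ - w y ^ γ) 0 ^ 2 ≤
      w x ^ s * (K * (max (w x - w y) 0 * (w x ^ θ - w y ^ θ))) := fun x y => by
    rcases le_total (w y) (w x) with h | h
    · have h1 : w y ^ γ ≤ w x ^ γ := Real.rpow_le_rpow (hw y) h (by linarith)
      rw [max_eq_left (by linarith), max_eq_left (by linarith)]
      have := rpow_sub_rpow_sq_le hγ1 hθ0 (hw y) h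
      rw [hexp] at this
      linarith
    · have h1 : w x ^ γ ≤ w y ^ γ := Real.rpow_le_rpow (hw x) h (by linarith)
      rw [max_eq_right (by linarith), max_eq_right (by linarith)]
      simp
  have henergy : ∀ x y, 0 ≤ max (w x - w y) 0 * (w x ^ θ - w y ^ θ) := fun x y => by
    rcases le_total (w y) (w x) with h | h
    · have h1 : w y ^ θ ≤ w x ^ θ := Real.rpow_le_rpow (hw y) h hθ0.le
      exact mul_nonneg (le_max_right _ _) (by linarith)
    · rw [max_eq_right (by linarith), zero_mul]
  -- the exponents are chosen so that `2 γ - 1 - θ = s`, and Cauchy-Schwarz bounds `D` by the energy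
  have hCS : D ^ 2 ≤ (N * X) * (K * E) := by
    have := Finset.sum_sq_le_sum_mul_sum_of_sq_le_mul (A.sigma fun x => G.neighborFinset x)
      (r := fun z => max (w z.1 ^ γ - w z.2 ^ γ) 0) (f := fun z => w z.1 ^ s)
      (g := fun z => K * (max (w z.1 - w z.2) 0 * (w z.1 ^ θ - w z.2 ^ θ)))
      (fun z _ => Real.rpow_nonneg (hw _) _) (fun z _ => mul_nonneg hK0 (henergy _ _))
      (fun z _ => hterm _ _)
    rw [Finset.sum_sigma, Finset.sum_sigma, Finset.sum_sigma] at this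
    refine this.trans ?_
    simp only [← Finset.mul_sum]
    refine mul_le_mul_of_nonneg_right ?_ (mul_nonneg hK0
      (Finset.sum_nonneg fun x _ => Finset.sum_nonneg fun y _ => henergy x y))
    rw [hX, Finset.mul_sum]
    refine Finset.sum_le_sum fun x _ => ?_
    rw [Finset.sum_const, card_neighborFinset_eq_degree, nsmul_eq_mul]
    exact mul_le_mul_of_nonneg_right (by exact_mod_cast hN x) (Real.rpow_nonneg (hw x) _)
  have hsq : X ^ ((d - 1) / d) * X ^ ((d - 1) / d) ≤
      κ ^ 2 * ((N * X) * (K * (N * (X ^ (1 - 1 / m) * Y ^ (1 / m))))) := by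
    have h0 : 0 ≤ X ^ ((d - 1) / d) := by positivity
    calc X ^ ((d - 1) / d) * X ^ ((d - 1) / d) ≤ (κ * D) * (κ * D) := by gcongr
      _ = κ ^ 2 * D ^ 2 := by ring
      _ ≤ κ ^ 2 * ((N * X) * (K * E)) := by gcongr
      _ ≤ _ := by gcongr
  -- `2 (d - 1) / d = 1 / s + 1 + (1 - 1 / m)`, so a power of `X` cancels
  have hpow : X ^ ((d - 1) / d) * X ^ ((d - 1) / d) = X ^ (1 / s) * (X * X ^ (1 - 1 / m)) := by
    nth_rewrite 4 [← Real.rpow_one X]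
    rw [← Real.rpow_add hXpos, ← Real.rpow_add hXpos, ← Real.rpow_add hXpos, hs]
    congr 1
    field_simp
    ring
  rw [hpow] at hsq
  have hpos : 0 < X * X ^ (1 - 1 / m) := by positivity
  refine le_of_mul_le_mul_right (hsq.trans (le_of_eq ?_)) hpos
  ring

end Green

/-! ### Solving `(I - P) u = f` -/

section Poisson

variable {V : Type*} {G : SimpleGraph V} [G.LocallyFinite] {𝕜 : Type*} [RCLike 𝕜]

theorem walkOp_add (f g : V → 𝕜) (x : V) :
    G.walkOp (f + g) x = G.walkOp f x + G.walkOp g x := by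
  simp [walkOp, Finset.sum_add_distrib, add_div]

theorem walkOp_sub (f g : V → 𝕜) (x : V) :
    G.walkOp (f - g) x = G.walkOp f x - G.walkOp g x := by
  simp [walkOp, Finset.sum_sub_distrib, sub_div]

theorem walkOp_smul (c : 𝕜) (f : V → 𝕜) (x : V) :
    G.walkOp (c • f) x = c * G.walkOp f x := by
  simp [walkOp, ← Finset.mul_sum, mul_div_assoc]

theorem norm_walkOp_le (f : V → 𝕜) (x : V) :
    ‖G.walkOp f x‖ ≤ G.walkOp (fun y => ‖f y‖) x := by
  rw [walkOp, walkOp, norm_div, RCLike.norm_natCast]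
  exact div_le_div_of_nonneg_right (norm_sum_le _ _) (Nat.cast_nonneg _)

theorem tendsto_walkOp {ι : Type*} {l : Filter ι} {u : ι → V → 𝕜} {v : V → 𝕜}
    (h : ∀ x, Filter.Tendsto (fun i => u i x) l (nhds (v x))) (x : V) :
    Filter.Tendsto (fun i => G.walkOp (u i) x) l (nhds (G.walkOp v x)) :=
  (tendsto_finsetSum _ fun y _ => h y).div_const _

/-- The Green estimate for scalar functions: `w = ‖u‖` satisfies `w ≤ ‖(I - P) u‖ + P w`. -/
theorem green_estimate_norm {N : ℕ} (hN : ∀ x, G.degree x ≤ N)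
    {d : ℝ} (hIS : G.HasIS d) {m s : ℝ} (hm : 1 < m) (hmd : m < d / 2)
    (hs0 : 0 < s) (hs : 1 / s = 1 / m - 2 / d) :
    ∃ C : ℝ, 0 ≤ C ∧ ∀ (A : Finset V) (u : V → 𝕜) (M : ℝ), (∀ x, x ∉ A → u x = 0) →
      (∑ x ∈ A, ‖u x - G.walkOp u x‖ ^ m ≤ M) →
      ∀ B : Finset V, ∑ x ∈ B, ‖u x‖ ^ s ≤ (C * M ^ (1 / m)) ^ s := by
  classical
  obtain ⟨C, hC, h⟩ := green_estimate hN hIS hm hmd hs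
  refine ⟨C, hC, fun A u M huA hM B => ?_⟩
  have key := h A (fun x => ‖u x‖) (fun x => ‖u x - G.walkOp u x‖) (fun x => norm_nonneg _)
    (fun x hx => by simp [huA x hx]) (fun x => norm_nonneg _) (fun x _ => by
      have h1 := norm_le_norm_sub_add (u x) (G.walkOp u x)
      have h2 := norm_walkOp_le (G := G) u x
      linarith)
  have hnn : ∀ (A : Finset V) (r : ℝ) (f : V → 𝕜), 0 ≤ ∑ x ∈ A, ‖f x‖ ^ r := fun A r f =>
    Finset.sum_nonneg fun x _ => Real.rpow_nonneg (norm_nonneg _) _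
  have hBA : ∑ x ∈ B, ‖u x‖ ^ s ≤ ∑ x ∈ A, ‖u x‖ ^ s := by
    calc ∑ x ∈ B, ‖u x‖ ^ s ≤ ∑ x ∈ B ∪ A, ‖u x‖ ^ s :=
          Finset.sum_le_sum_of_subset_of_nonneg Finset.subset_union_left
            fun x _ _ => Real.rpow_nonneg (norm_nonneg _) _
      _ = ∑ x ∈ A, ‖u x‖ ^ s := by
          refine (Finset.sum_subset Finset.subset_union_right fun x _ hx => ?_).symm
          rw [huA x hx, norm_zero, Real.zero_rpow hs0.ne']
  refine hBA.trans ?_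
  have h3 : (∑ x ∈ A, ‖u x - G.walkOp u x‖ ^ m) ^ (1 / m) ≤ M ^ (1 / m) :=
    Real.rpow_le_rpow (hnn A m fun x => u x - G.walkOp u x) hM (by positivity)
  calc ∑ x ∈ A, ‖u x‖ ^ s = ((∑ x ∈ A, ‖u x‖ ^ s) ^ (1 / s)) ^ s := by
        rw [← Real.rpow_mul (hnn A s u), one_div_mul_cancel hs0.ne', Real.rpow_one]
    _ ≤ (C * M ^ (1 / m)) ^ s := by
        refine Real.rpow_le_rpow (Real.rpow_nonneg (hnn A s u) _) (key.trans ?_) hs0.le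
        gcongr

/-- The Dirichlet problem on a finite set; the Green estimate gives uniqueness, hence existence. -/
theorem exists_dirichlet_solution {N : ℕ} (hN : ∀ x, G.degree x ≤ N)
    {d : ℝ} (hIS : G.HasIS d) (hd : 2 < d) (A : Finset V) (f : V → 𝕜) :
    ∃ u : V → 𝕜, (∀ x, x ∉ A → u x = 0) ∧ ∀ x ∈ A, u x - G.walkOp u x = f x := by
  classical
  let e : (A → 𝕜) → V → 𝕜 := fun u x => if h : x ∈ A then u ⟨x, h⟩ else 0
  have he : ∀ u (x : A), e u x = u x := fun u x => by simp [e]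
  have heA : ∀ u x, x ∉ A → e u x = 0 := fun u x hx => by simp [e, hx]
  have eadd : ∀ u v, e (u + v) = e u + e v := fun u v => by
    funext x
    by_cases h : x ∈ A <;> simp [e, h]
  have esmul : ∀ (c : 𝕜) u, e (c • u) = c • e u := fun c u => by
    funext x
    by_cases h : x ∈ A <;> simp [e, h]
  let T : (A → 𝕜) →ₗ[𝕜] (A → 𝕜) :=
    { toFun := fun u x => e u x - G.walkOp (e u) x
      map_add' := fun u v => by
        funext x
        simp only [eadd, walkOp_add, Pi.add_apply]
        ring
      map_smul' := fun c u => by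
        funext x
        simp only [esmul, walkOp_smul, Pi.smul_apply, smul_eq_mul, RingHom.id_apply]
        ring }
  obtain ⟨m, hm1, hmd⟩ : ∃ m, 1 < m ∧ m < d / 2 := exists_between (by linarith)
  have hpos : 0 < 1 / m - 2 / d := by
    rw [sub_pos, div_lt_div_iff₀ (by linarith) (by linarith)]; linarith
  obtain ⟨C, -, hC⟩ := green_estimate_norm (𝕜 := 𝕜) hN hIS hm1 hmd
    (s := 1 / (1 / m - 2 / d)) (by positivity) (by rw [one_div_one_div])
  have hinj : Function.Injective T := by
    rw [← LinearMap.ker_eq_bot, LinearMap.ker_eq_bot']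
    intro u hu
    have h0 : ∀ x ∈ A, e u x - G.walkOp (e u) x = 0 := fun x hx => congrFun hu ⟨x, hx⟩
    funext x
    have hM : ∑ x ∈ A, ‖e u x - G.walkOp (e u) x‖ ^ m ≤ 0 :=
      (Finset.sum_eq_zero fun x hx => by
        rw [h0 x hx, norm_zero, Real.zero_rpow (by linarith)]).le
    have h1 := hC A (e u) 0 (heA u) hM {(x : V)}
    rw [Finset.sum_singleton, Real.zero_rpow (by positivity), mul_zero,
      Real.zero_rpow (by positivity), he] at h1
    have h2 := le_antisymm h1 (Real.rpow_nonneg (norm_nonneg _) _)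
    rw [Real.rpow_eq_zero (norm_nonneg _) (by positivity)] at h2
    simpa using h2
  obtain ⟨u, hu⟩ := LinearMap.injective_iff_surjective.1 hinj fun x => f x
  exact ⟨e u, heA u, fun x hx => congrFun hu ⟨x, hx⟩⟩

/-- A family which is bounded in `ℓ^s` has a pointwise limit along an ultrafilter. -/
theorem exists_pointwise_limit_of_sum_rpow_le {V ι : Type*} (l : Filter ι) [l.NeBot]
    (u : ι → V → 𝕜) {s M : ℝ} (hs : 0 < s)
    (h : ∀ i (B : Finset V), ∑ x ∈ B, ‖u i x‖ ^ s ≤ M) :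
    ∃ U : Ultrafilter ι, ↑U ≤ l ∧ ∃ v : V → 𝕜,
      (∀ x, Filter.Tendsto (fun i => u i x) U (nhds (v x))) ∧
      ∀ B : Finset V, ∑ x ∈ B, ‖v x‖ ^ s ≤ M := by
  have hbd : ∀ i x, u i x ∈ Metric.closedBall (0 : 𝕜) (M ^ s⁻¹) := fun i x => by
    have h1 := h i {x}
    rw [Finset.sum_singleton] at h1
    rw [mem_closedBall_zero_iff]
    calc ‖u i x‖ = (‖u i x‖ ^ s) ^ s⁻¹ := (Real.rpow_rpow_inv (norm_nonneg _) hs.ne').symm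
      _ ≤ M ^ s⁻¹ :=
        Real.rpow_le_rpow (Real.rpow_nonneg (norm_nonneg _) _) h1 (by positivity)
  have : ProperSpace 𝕜 := FiniteDimensional.proper_rclike 𝕜 𝕜
  let U := Ultrafilter.of l
  have hex : ∀ x, ∃ z, Filter.Tendsto (fun i => u i x) U (nhds z) := fun x => by
    obtain ⟨z, -, hz⟩ := (isCompact_closedBall (0 : 𝕜) (M ^ s⁻¹)).ultrafilter_le_nhds'
      (U.map fun i => u i x) (Ultrafilter.mem_map.2 (Filter.univ_mem' fun i => hbd i x))
    exact ⟨z, hz⟩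
  choose v hv using hex
  refine ⟨U, Ultrafilter.of_le l, v, hv, fun B => ?_⟩
  have hlim : Filter.Tendsto (fun i => ∑ x ∈ B, ‖u i x‖ ^ s) U (nhds (∑ x ∈ B, ‖v x‖ ^ s)) :=
    tendsto_finsetSum _ fun x _ =>
      (hv x).norm.rpow_const (Or.inr hs.le)
  exact le_of_tendsto hlim (Filter.Eventually.of_forall fun i => h i B)

/-- Solvability of `(I - P) u = f` with `u` in `ℓ^s` for `f` in `ℓ^m`, where `1/s = 1/m - 2/d`: the
solution is a pointwise limit of the solutions of the Dirichlet problems on finite sets. -/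
theorem exists_sub_walkOp_eq {N : ℕ} (hN : ∀ x, G.degree x ≤ N)
    {d : ℝ} (hIS : G.HasIS d) {m s : ℝ} (hm : 1 < m) (hmd : m < d / 2)
    (hs0 : 0 < s) (hs : 1 / s = 1 / m - 2 / d) {f : V → 𝕜} {M : ℝ}
    (hf : ∀ B : Finset V, ∑ x ∈ B, ‖f x‖ ^ m ≤ M) :
    ∃ u : V → 𝕜, (∃ M' : ℝ, ∀ B : Finset V, ∑ x ∈ B, ‖u x‖ ^ s ≤ M') ∧
      ∀ x, u x - G.walkOp u x = f x := by
  obtain ⟨C, -, hC⟩ := green_estimate_norm (𝕜 := 𝕜) hN hIS hm hmd hs0 hs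
  choose u huA huf using fun A : Finset V =>
    exists_dirichlet_solution hN hIS (by linarith) A f
  have hbd : ∀ A B : Finset V, ∑ x ∈ B, ‖u A x‖ ^ s ≤ (C * M ^ (1 / m)) ^ s := fun A =>
    hC A (u A) M (huA A) ((Finset.sum_congr rfl fun x hx => by rw [huf A x hx]).trans_le (hf A))
  obtain ⟨U, hU, v, hv, hvM⟩ := exists_pointwise_limit_of_sum_rpow_le
    (Filter.atTop : Filter (Finset V)) u hs0 hbd
  refine ⟨v, ⟨_, hvM⟩, fun x => ?_⟩
  refine tendsto_nhds_unique ((hv x).sub (tendsto_walkOp hv x)) ?_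
  refine tendsto_const_nhds.congr' ?_
  filter_upwards [hU (Filter.eventually_ge_atTop ({x} : Finset V))] with A hA
  exact (huf A x (hA (Finset.mem_singleton_self x))).symm

end Poisson

/-! ### Gradients and `ℓ^p` spaces -/

section Gradients

variable {V : Type*} {G : SimpleGraph V} {𝕜 : Type*} [RCLike 𝕜]

theorem tendsto_cofinite_zero_of_sum_rpow_le {u : V → 𝕜} {s M : ℝ} (hs : 0 < s)
    (h : ∀ B : Finset V, ∑ x ∈ B, ‖u x‖ ^ s ≤ M) :
    Filter.Tendsto u Filter.cofinite (nhds 0) := by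
  have hsum : Summable fun x => ‖u x‖ ^ s :=
    summable_of_sum_le (fun x => Real.rpow_nonneg (norm_nonneg _) _) h
  have h1 := hsum.tendsto_cofinite_zero.rpow_const (p := s⁻¹) (Or.inr (by positivity))
  rw [Real.zero_rpow (by positivity)] at h1
  rw [tendsto_zero_iff_norm_tendsto_zero]
  exact h1.congr fun x => Real.rpow_rpow_inv (norm_nonneg _) hs.ne'

theorem exists_finset_dart_sum_eq [G.LocallyFinite] (B : Finset V) (e : V → V → ℝ) :
    ∃ T : Finset G.Dart,
      ∑ x ∈ B, ∑ y ∈ G.neighborFinset x, e x y = ∑ a ∈ T, e a.fst a.snd := by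
  classical
  have hinj : Function.Injective fun a : G.Dart => (⟨a.fst, a.snd⟩ : Σ _ : V, V) := by
    intro a b hab
    have h1 : a.fst = b.fst := congrArg Sigma.fst hab
    have h2 : a.snd = b.snd := by simpa using (Sigma.mk.inj hab).2
    exact Dart.toProd_injective (Prod.ext h1 h2)
  refine ⟨(B.sigma fun x => G.neighborFinset x).preimage _ hinj.injOn, ?_⟩
  rw [Finset.sum_sigma', Finset.sum_preimage (fun a : G.Dart => (⟨a.fst, a.snd⟩ : Σ _ : V, V)) _ hinj.injOn
    (fun z => e z.1 z.2)]
  rintro ⟨x, y⟩ hz hr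
  have hadj : G.Adj x y := by simpa using (Finset.mem_sigma.1 hz).2
  exact absurd ⟨⟨(x, y), hadj⟩, rfl⟩ hr

/-- By convexity of `t ↦ t ^ m`, the function `(I - P) g` is in `ℓ^m` if `∇ g` is. -/
theorem sum_norm_sub_walkOp_rpow_le [G.LocallyFinite] (hdeg : ∀ x, 0 < G.degree x)
    {m : ℝ} (hm : 1 ≤ m) (g : V → 𝕜) {M : ℝ}
    (hM : ∀ T : Finset G.Dart, ∑ a ∈ T, ‖G.grad 𝕜 g a‖ ^ m ≤ M) (B : Finset V) :
    ∑ x ∈ B, ‖g x - G.walkOp g x‖ ^ m ≤ M := by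
  obtain ⟨T, hT⟩ := exists_finset_dart_sum_eq (G := G) B fun x y => ‖g y - g x‖ ^ m
  refine le_trans ?_ (hT.trans_le (hM T))
  refine Finset.sum_le_sum fun x _ => ?_
  have hD : (1 : ℝ) ≤ G.degree x := by exact_mod_cast hdeg x
  have hD0 : (0 : ℝ) < G.degree x := by linarith
  have h1 : G.degree x * ‖g x - G.walkOp g x‖ ≤ ∑ y ∈ G.neighborFinset x, ‖g y - g x‖ := by
    rw [← RCLike.norm_natCast (K := 𝕜), ← norm_mul, ← sum_sub_eq_degree_mul]
    refine (norm_sum_le _ _).trans_eq (Finset.sum_congr rfl fun y _ => norm_sub_rev _ _)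
  have h2 := Real.rpow_sum_le_const_mul_sum_rpow_of_nonneg (s := G.neighborFinset x)
    (f := fun y => ‖g y - g x‖) hm (fun _ _ => norm_nonneg _)
  rw [card_neighborFinset_eq_degree] at h2
  have h3 : (G.degree x : ℝ) ^ m * ‖g x - G.walkOp g x‖ ^ m ≤
      (G.degree x : ℝ) ^ m * ∑ y ∈ G.neighborFinset x, ‖g y - g x‖ ^ m := by
    rw [← Real.mul_rpow hD0.le (norm_nonneg _)]
    refine (Real.rpow_le_rpow (by positivity) h1 (by linarith)).trans (h2.trans ?_)
    refine mul_le_mul_of_nonneg_right (Real.rpow_le_rpow_of_exponent_le hD (by linarith)) ?_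
    exact Finset.sum_nonneg fun y _ => Real.rpow_nonneg (norm_nonneg _) _
  exact le_of_mul_le_mul_left h3 (by positivity)

theorem card_filter_fst_eq_le [G.LocallyFinite] [DecidableEq V] (T : Finset G.Dart) (x : V) :
    (T.filter fun a => a.fst = x).card ≤ G.degree x := by
  rw [← card_neighborFinset_eq_degree]
  refine Finset.card_le_card_of_injOn (fun a : G.Dart => a.snd) (fun a ha => ?_)
    (fun a ha b hb hab => ?_)
  · rw [Finset.mem_coe, Finset.mem_filter] at ha
    rw [Finset.mem_coe, mem_neighborFinset, ← ha.2]
    exact a.adj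
  · rw [Finset.mem_coe, Finset.mem_filter] at ha hb
    exact Dart.toProd_injective (Prod.ext (ha.2.trans hb.2.symm) hab)

theorem summable_dart_fst [G.LocallyFinite] {N : ℕ} (hN : ∀ x, G.degree x ≤ N) {f : V → ℝ}
    (hf0 : ∀ x, 0 ≤ f x) (hf : Summable f) : Summable fun a : G.Dart => f a.fst := by
  classical
  refine summable_of_sum_le (c := N * ∑' x, f x) (fun a => hf0 _) fun T => ?_
  rw [Finset.sum_comp f (fun a : G.Dart => a.fst)]
  calc ∑ x ∈ T.image (fun a : G.Dart => a.fst), (T.filter fun a => a.fst = x).card • f x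
      ≤ ∑ x ∈ T.image (fun a : G.Dart => a.fst), N * f x := by
        refine Finset.sum_le_sum fun x _ => ?_
        rw [nsmul_eq_mul]
        exact mul_le_mul_of_nonneg_right
          (Nat.cast_le.2 ((card_filter_fst_eq_le T x).trans (hN x))) (hf0 x)
    _ ≤ N * ∑' x, f x := by
        rw [← Finset.mul_sum]
        exact mul_le_mul_of_nonneg_left (hf.sum_le_tsum _ fun x _ => hf0 x) (Nat.cast_nonneg N)

theorem memℓp_grad [G.LocallyFinite] {N : ℕ} (hN : ∀ x, G.degree x ≤ N) {p : ℝ≥0∞}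
    (hp : 0 < p.toReal) {u : V → 𝕜} (hu : Memℓp u p) : Memℓp (G.grad 𝕜 u) p := by
  have hfst : Summable fun a : G.Dart => ‖u a.fst‖ ^ p.toReal :=
    summable_dart_fst hN (fun x => Real.rpow_nonneg (norm_nonneg (u x)) p.toReal) (hu.summable hp)
  have hsnd : Summable fun a : G.Dart => ‖u a.snd‖ ^ p.toReal :=
    hfst.comp_injective (i := Dart.symm) Dart.symm_involutive.injective
  have e : G.grad 𝕜 u = (fun a => u a.snd) - fun a => u a.fst := rfl
  rw [e]
  exact (memℓp_gen hsnd).sub (memℓp_gen hfst)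

/-- Dominated convergence in `ℓ^p`. -/
theorem mem_of_isClosed_of_dominated {ι α : Type*} {p : ℝ≥0∞} [Fact (1 ≤ p)]
    (hp : 0 < p.toReal) {S : Set (lp (fun _ : α => 𝕜) p)} (hS : IsClosed S)
    {ω : lp (fun _ : α => 𝕜) p} {l : Filter ι} [l.NeBot] {f : ι → lp (fun _ : α => 𝕜) p}
    (hf : ∀ i, f i ∈ S) (hlim : ∀ a, Filter.Tendsto (fun i => f i a) l (nhds (ω a))) {C : ℝ}
    (hC : ∀ i a, ‖f i a‖ ≤ C * ‖ω a‖) : ω ∈ S := by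
  refine hS.mem_of_tendsto (b := l) (f := f) ?_ (Filter.Eventually.of_forall hf)
  rw [tendsto_iff_norm_sub_tendsto_zero]
  have hsum : Summable fun a => (C + 1) ^ p.toReal * ‖ω a‖ ^ p.toReal :=
    ((lp.memℓp ω).summable hp).mul_left _
  have hle : ∀ i a, ‖f i a - ω a‖ ≤ (C + 1) * ‖ω a‖ := fun i a => by
    have := norm_sub_le (f i a) (ω a)
    linarith [hC i a]
  have key := tendsto_tsum_of_dominated_convergence (𝓕 := l)
    (f := fun i a => ‖f i a - ω a‖ ^ p.toReal) (g := fun _ => (0 : ℝ)) hsum (fun a => by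
      have h1 := (tendsto_iff_norm_sub_tendsto_zero.1 (hlim a)).rpow_const (p := p.toReal)
        (Or.inr hp.le)
      rwa [Real.zero_rpow hp.ne'] at h1)
    (Filter.Eventually.of_forall fun i a => by
      rw [Real.norm_of_nonneg (Real.rpow_nonneg (norm_nonneg _) _)]
      rcases (norm_nonneg (ω a)).eq_or_lt with h0 | h0
      · have h1 := hle i a
        rw [← h0, mul_zero] at h1
        rw [le_antisymm h1 (norm_nonneg _), ← h0, Real.zero_rpow hp.ne', mul_zero]
      · have hC0 : 0 ≤ C + 1 := by
          by_contra h
          have := mul_neg_of_neg_of_pos (not_le.1 h) h0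
          linarith [hle i a, norm_nonneg (f i a - ω a)]
        rw [← Real.mul_rpow hC0 h0.le]
        exact Real.rpow_le_rpow (norm_nonneg _) (hle i a) hp.le)
  rw [tsum_zero] at key
  have h2 := key.rpow_const (p := 1 / p.toReal) (Or.inr (by positivity))
  rw [Real.zero_rpow (by positivity)] at h2
  refine h2.congr fun i => ?_
  rw [lp.norm_eq_tsum_rpow hp]
  rfl

theorem mem_of_isClosed_of_grad_dominated {ι : Type*} {p : ℝ≥0∞} [Fact (1 ≤ p)]
    (hp : 0 < p.toReal) {S : Set (G.EdgeLp 𝕜 p)} (hS : IsClosed S)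
    {ω : G.EdgeLp 𝕜 p} {g : V → 𝕜} (hω : ∀ a, ω a = G.grad 𝕜 g a)
    {l : Filter ι} [l.NeBot] {u : ι → V → 𝕜}
    (hu : ∀ x, Filter.Tendsto (fun i => u i x) l (nhds (g x))) {C : ℝ}
    (hC : ∀ i x y, ‖u i y - u i x‖ ≤ C * ‖g y - g x‖)
    (hS' : ∀ i (η : G.EdgeLp 𝕜 p), (∀ a, η a = G.grad 𝕜 (u i) a) → η ∈ S) : ω ∈ S := by
  have hdom : ∀ i a, ‖G.grad 𝕜 (u i) a‖ ≤ C * ‖ω a‖ := fun i a => by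
    rw [hω]; exact hC i a.fst a.snd
  have hmem : ∀ i, Memℓp (G.grad 𝕜 (u i)) p := fun i => by
    refine (((lp.memℓp ω).norm).const_mul C).mono fun a => hdom i a
  exact mem_of_isClosed_of_dominated hp hS (f := fun i => (⟨_, hmem i⟩ : G.EdgeLp 𝕜 p))
    (fun i => hS' i _ fun a => rfl)
    (fun a => by rw [hω]; exact (hu a.snd).sub (hu a.fst)) hdom

/-- Truncation of the real and imaginary parts of a scalar to `[-t, t]`. -/
def clamp (t : ℝ) (z : 𝕜) : 𝕜 :=
  (max (-t) (min t (RCLike.re z)) : ℝ) + (max (-t) (min t (RCLike.im z)) : ℝ) * RCLike.I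

theorem clamp_of_norm_le {t : ℝ} {z : 𝕜} (h : ‖z‖ ≤ t) : clamp t z = z := by
  have h1 := abs_le.1 ((RCLike.abs_re_le_norm z).trans h)
  have h2 := abs_le.1 ((RCLike.abs_im_le_norm z).trans h)
  rw [clamp, min_eq_right h1.2, min_eq_right h2.2, max_eq_right h1.1, max_eq_right h2.1,
    RCLike.re_add_im]

theorem norm_clamp_sub_clamp_le (t : ℝ) (z w : 𝕜) : ‖clamp t z - clamp t w‖ ≤ 2 * ‖z - w‖ := by
  have key : ∀ a b : ℝ, |max (-t) (min t a) - max (-t) (min t b)| ≤ |a - b| := fun a b => by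
    refine (abs_max_sub_max_le_max _ _ _ _).trans (max_le (by simp) ?_)
    exact (abs_min_sub_min_le_max _ _ _ _).trans (max_le (by simp) le_rfl)
  have h1 := (key (RCLike.re z) (RCLike.re w)).trans
    ((map_sub (RCLike.re (K := 𝕜)) z w ▸ RCLike.abs_re_le_norm (z - w)))
  have h2 := (key (RCLike.im z) (RCLike.im w)).trans
    ((map_sub (RCLike.im (K := 𝕜)) z w ▸ RCLike.abs_im_le_norm (z - w)))
  have e : clamp t z - clamp t w =
      ((max (-t) (min t (RCLike.re z)) - max (-t) (min t (RCLike.re w)) : ℝ) : 𝕜) +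
      ((max (-t) (min t (RCLike.im z)) - max (-t) (min t (RCLike.im w)) : ℝ) : 𝕜) * RCLike.I := by
    simp only [clamp]; push_cast; ring
  rw [e]
  refine (norm_add_le _ _).trans ?_
  rw [norm_mul, RCLike.norm_ofReal, RCLike.norm_ofReal]
  have hI : ‖(RCLike.I : 𝕜)‖ ≤ 1 := by
    rcases eq_or_ne (RCLike.I : 𝕜) 0 with h | h
    · simp [h]
    · exact (RCLike.norm_I_of_ne_zero h).le
  have := mul_le_mul h2 hI (norm_nonneg _) (norm_nonneg _)
  linarith

theorem norm_clamp_le {t : ℝ} (ht : 0 ≤ t) (z : 𝕜) : ‖clamp t z‖ ≤ 2 * t := by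
  have key : ∀ a : ℝ, |max (-t) (min t a)| ≤ t := fun a =>
    abs_le.2 ⟨le_max_left _ _, max_le (by linarith) (min_le_left _ _)⟩
  rw [clamp]
  refine (norm_add_le _ _).trans ?_
  rw [norm_mul, RCLike.norm_ofReal, RCLike.norm_ofReal]
  have hI : ‖(RCLike.I : 𝕜)‖ ≤ 1 := by
    rcases eq_or_ne (RCLike.I : 𝕜) 0 with h | h
    · simp [h]
    · exact (RCLike.norm_I_of_ne_zero h).le
  have := mul_le_mul (key (RCLike.im z)) hI (norm_nonneg _) ht
  linarith [key (RCLike.re z)]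

end Gradients

/-! ### Triviality in reduced cohomology -/

section Triviality

variable {V : Type*} {G : SimpleGraph V} {𝕜 : Type*} [RCLike 𝕜]

/-- A gradient in `ℓ^p` of a function vanishing at infinity is a limit of gradients of finitely
supported functions: subtracting from `g` its truncation at height `ε` leaves a finitely supported
function. -/
theorem mem_closure_of_tendsto_cofinite_zero {p : ℝ≥0∞} [Fact (1 ≤ p)] (hp : 0 < p.toReal)
    {ω : G.EdgeLp 𝕜 p} {g : V → 𝕜} (hω : ∀ a, ω a = G.grad 𝕜 g a)
    (hg : Filter.Tendsto g Filter.cofinite (nhds 0)) :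
    ω ∈ closure {η : G.EdgeLp 𝕜 p | ∃ f : V → 𝕜, {x | f x ≠ 0}.Finite ∧
      ∀ a, η a = G.grad 𝕜 f a} := by
  have hε : ∀ n : ℕ, (0 : ℝ) < 1 / ((n : ℝ) + 1) := fun n => Nat.one_div_pos_of_nat
  refine mem_of_isClosed_of_grad_dominated hp isClosed_closure hω (l := Filter.atTop)
    (u := fun (n : ℕ) x => g x - clamp (1 / ((n : ℝ) + 1)) (g x)) (C := 3) (fun x => ?_)
    (fun n x y => ?_) fun n η hη => subset_closure ⟨_, ?_, hη⟩
  · have h0 : Filter.Tendsto (fun n : ℕ => clamp (1 / ((n : ℝ) + 1)) (g x)) Filter.atTop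
        (nhds 0) := by
      refine squeeze_zero_norm (fun n => norm_clamp_le (hε n).le (g x)) ?_
      simpa using (tendsto_one_div_add_atTop_nhds_zero_nat (𝕜 := ℝ)).const_mul 2
    simpa using (tendsto_const_nhds (x := g x)).sub h0
  · have h1 := norm_clamp_sub_clamp_le (1 / ((n : ℝ) + 1)) (g y) (g x)
    have h2 := norm_sub_le (g y - g x)
      (clamp (1 / ((n : ℝ) + 1)) (g y) - clamp (1 / ((n : ℝ) + 1)) (g x))
    rw [sub_sub_sub_comm]
    linarith
  · have h1 := hg (Metric.ball_mem_nhds 0 (hε n))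
    rw [Filter.mem_map, Filter.mem_cofinite] at h1
    refine h1.subset fun x hx hx' => hx ?_
    rw [Set.mem_preimage, mem_ball_zero_iff] at hx'
    rw [clamp_of_norm_le hx'.le, sub_self]

theorem closure_gradOfLp_eq {p : ℝ≥0∞} [Fact (1 ≤ p)] (hp : 0 < p.toReal) :
    closure (G.gradOfLp 𝕜 p : Set (G.EdgeLp 𝕜 p)) =
      closure {η : G.EdgeLp 𝕜 p | ∃ f : V → 𝕜, {x | f x ≠ 0}.Finite ∧
        ∀ a, η a = G.grad 𝕜 f a} := by
  refine Set.Subset.antisymm (closure_minimal ?_ isClosed_closure) (closure_mono ?_)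
  · rintro ω ⟨g, hg, hω⟩
    exact mem_closure_of_tendsto_cofinite_zero hp hω
      (tendsto_cofinite_zero_of_sum_rpow_le hp ((memℓp_gen_iff' hp).1 hg))
  · rintro η ⟨f, hf, hη⟩
    exact ⟨f, (memℓp_zero hf).of_exponent_ge zero_le, hη⟩

theorem exists_eq_add_const_of_grad_eq (hconn : G.Connected) {f g : V → 𝕜}
    (h : ∀ a, G.grad 𝕜 f a = G.grad 𝕜 g a) : ∃ c, ∀ x, f x = g x + c := by
  obtain ⟨o⟩ := hconn.nonempty
  refine ⟨f o - g o, fun x => ?_⟩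
  have key : ∀ x y, G.Walk x y → f x - g x = f y - g y := fun x y w => by
    induction w with
    | nil => rfl
    | cons hadj _ ih =>
      rw [← ih]
      have h1 := h ⟨(_, _), hadj⟩
      change f _ - f _ = g _ - g _ at h1
      linear_combination -h1
  obtain ⟨w⟩ := hconn.preconnected x o
  linear_combination key x o w

theorem HasIS.degree_pos [G.LocallyFinite] {d : ℝ} (hIS : G.HasIS d) (x : V) :
    0 < G.degree x := by
  obtain ⟨κ, hκ, h⟩ := hIS
  by_contra h0
  have h1 := h {x} (Finset.singleton_nonempty x)
  have h2 : G.edgeBoundary {x} = ∅ := by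
    refine Set.eq_empty_of_forall_notMem fun a ha => h0 ?_
    have h3 : a.fst = x := by simpa using ha.1
    rw [degree_pos_iff_exists_adj]
    exact ⟨a.snd, h3 ▸ a.adj⟩
  rw [h2] at h1
  simp at h1
  linarith

theorem HasIS.infinite {d : ℝ} (hIS : G.HasIS d) [Nonempty V] : Infinite V := by
  by_contra hfin
  rw [not_infinite_iff_finite] at hfin
  obtain ⟨κ, hκ, h⟩ := hIS
  have : Fintype V := Fintype.ofFinite V
  have h1 := h Finset.univ Finset.univ_nonempty
  have h2 : G.edgeBoundary Finset.univ = ∅ :=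
    Set.eq_empty_of_forall_notMem fun a ha => ha.2 (Finset.mem_univ _)
  rw [h2, Set.ncard_empty, Nat.cast_zero, mul_zero] at h1
  have h3 : (0 : ℝ) < (Finset.univ : Finset V).card := by
    exact_mod_cast Finset.univ_nonempty.card_pos
  exact absurd h1 (not_le.2 (Real.rpow_pos_of_pos h3 _))

/-- Limits in `ℓ^p` of gradients of finitely supported functions are gradients of functions which
vanish at infinity: by the Green estimate, the finitely supported functions are bounded in `ℓ^s`
for some `s`. The exponent `p = 1` is excluded only because it is for the Green estimate. -/
theorem exists_tendsto_of_mem_closure_of_one_lt [G.LocallyFinite] (hconn : G.Connected) {N : ℕ}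
    (hN : ∀ x, G.degree x ≤ N) {d : ℝ} (hIS : G.HasIS d) {p : ℝ≥0∞} [Fact (1 ≤ p)]
    (hp1 : 1 < p.toReal) (hpd : p.toReal < d / 2)
    {ω : G.EdgeLp 𝕜 p} {g : V → 𝕜} (hω : ∀ a, ω a = G.grad 𝕜 g a)
    (hmem : ω ∈ closure (G.gradOfLp 𝕜 p : Set (G.EdgeLp 𝕜 p))) :
    ∃ c, Filter.Tendsto (fun x => g x - c) Filter.cofinite (nhds 0) := by
  have hp0 : 0 < p.toReal := by linarith
  rw [closure_gradOfLp_eq hp0, mem_closure_iff_seq_limit] at hmem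
  obtain ⟨η, hη, hlim⟩ := hmem
  choose f hfin hf using hη
  have hpos : 0 < 1 / p.toReal - 2 / d := by
    rw [sub_pos, div_lt_div_iff₀ (by linarith) (by linarith)]; linarith
  have hs0 : 0 < 1 / (1 / p.toReal - 2 / d) := by positivity
  obtain ⟨C, -, hC⟩ := green_estimate_norm (𝕜 := 𝕜) hN hIS hp1 hpd hs0 (by rw [one_div_one_div])
  obtain ⟨R, hR⟩ := hlim.norm.bddAbove_range
  have hR' : ∀ n, ‖η n‖ ≤ R := fun n => hR ⟨n, rfl⟩
  have hbd : ∀ n (B : Finset V), ∑ x ∈ B, ‖f n x‖ ^ (1 / (1 / p.toReal - 2 / d)) ≤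
      (C * (R ^ p.toReal) ^ (1 / p.toReal)) ^ (1 / (1 / p.toReal - 2 / d)) := fun n => by
    refine hC (hfin n).toFinset (f n) (R ^ p.toReal) (fun x hx => ?_) ?_
    · simpa using hx
    · refine sum_norm_sub_walkOp_rpow_le hIS.degree_pos hp1.le (f n) (fun T => ?_) _
      calc ∑ a ∈ T, ‖G.grad 𝕜 (f n) a‖ ^ p.toReal = ∑ a ∈ T, ‖η n a‖ ^ p.toReal :=
            Finset.sum_congr rfl fun a _ => by rw [hf]
        _ ≤ ‖η n‖ ^ p.toReal := lp.sum_rpow_le_norm_rpow hp0 _ _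
        _ ≤ R ^ p.toReal := Real.rpow_le_rpow (norm_nonneg _) (hR' n) hp0.le
  obtain ⟨U, hU, v, hv, hvM⟩ := exists_pointwise_limit_of_sum_rpow_le Filter.atTop f hs0 hbd
  have hgrad : ∀ a, G.grad 𝕜 g a = G.grad 𝕜 v a := fun a => by
    have h1 : Filter.Tendsto (fun n => η n a) U (nhds (ω a)) :=
      (((lp.lipschitzWith_one_eval p a).continuous.tendsto ω).comp hlim).mono_left hU
    rw [← hω]
    refine tendsto_nhds_unique h1 (((hv a.snd).sub (hv a.fst)).congr fun n => ?_)
    rw [hf]; rfl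
  obtain ⟨c, hc⟩ := exists_eq_add_const_of_grad_eq hconn hgrad
  refine ⟨c, (tendsto_cofinite_zero_of_sum_rpow_le hs0 hvM).congr fun x => ?_⟩
  rw [hc]; ring

/-- For `p < d/2`, the class of `∇g` in reduced `ℓ^p`-cohomology is trivial if and only if `g` is
constant at infinity. The second condition does not involve `p`. -/
theorem mem_closure_gradOfLp_iff [G.LocallyFinite] (hconn : G.Connected) {N : ℕ}
    (hN : ∀ x, G.degree x ≤ N) {d : ℝ} (hIS : G.HasIS d) {p : ℝ≥0∞} [Fact (1 ≤ p)]
    (hpd : p < ENNReal.ofReal (d / 2))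
    {ω : G.EdgeLp 𝕜 p} {g : V → 𝕜} (hω : ∀ a, ω a = G.grad 𝕜 g a) :
    ω ∈ closure (G.gradOfLp 𝕜 p : Set (G.EdgeLp 𝕜 p)) ↔
      ∃ c, Filter.Tendsto (fun x => g x - c) Filter.cofinite (nhds 0) := by
  have h1p : 1 ≤ p := Fact.out
  constructor
  · intro hmem
    -- enlarging `p` makes it larger than `1`
    obtain ⟨p', hpp', hp'd⟩ := exists_between hpd
    have h1p' : 1 < p' := h1p.trans_lt hpp'
    have : Fact (1 ≤ p') := ⟨h1p'.le⟩
    have hp't : p' ≠ ∞ := (hp'd.trans ENNReal.ofReal_lt_top).ne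
    have hmaps : Set.MapsTo (lp.linearMapOfLE 𝕜 (fun _ : G.Dart => 𝕜) hpp'.le)
        (G.gradOfLp 𝕜 p : Set (G.EdgeLp 𝕜 p)) (G.gradOfLp 𝕜 p' : Set (G.EdgeLp 𝕜 p')) := by
      rintro η ⟨f, hf, hη⟩
      exact ⟨f, hf.of_exponent_ge hpp'.le, hη⟩
    refine exists_tendsto_of_mem_closure_of_one_lt hconn hN hIS ?_ ?_
      (ω := lp.linearMapOfLE 𝕜 (fun _ : G.Dart => 𝕜) hpp'.le ω) hω
      (hmaps.closure (continuous_linearMapOfLE hpp'.le) hmem)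
    · rwa [← ENNReal.toReal_one, ENNReal.toReal_lt_toReal ENNReal.one_ne_top hp't]
    · exact (ENNReal.lt_ofReal_iff_toReal_lt hp't).1 hp'd
  · rintro ⟨c, hc⟩
    have hp0 : 0 < p.toReal := ENNReal.toReal_pos (zero_lt_one.trans_le h1p).ne'
      (hpd.trans ENNReal.ofReal_lt_top).ne
    rw [closure_gradOfLp_eq hp0]
    refine mem_closure_of_tendsto_cofinite_zero hp0 (fun a => ?_) hc
    rw [hω]
    change g a.snd - g a.fst = (g a.snd - c) - (g a.fst - c)
    ring

end Triviality

/-! ### Harmonic functions -/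

section Harmonic

variable {V : Type*} {G : SimpleGraph V} [G.LocallyFinite] {𝕜 : Type*} [RCLike 𝕜]

/-- The maximum principle: a harmonic function that is constant at infinity is constant. -/
theorem IsHarmonic.eq_of_tendsto_cofinite [Infinite V] (hconn : G.Connected)
    {h : V → 𝕜} (hh : G.IsHarmonic h) {c : 𝕜}
    (hc : Filter.Tendsto (fun x => h x - c) Filter.cofinite (nhds 0)) (x : V) : h x = c := by
  by_contra hx
  have hnorm : Filter.Tendsto (fun y => ‖h y - c‖) Filter.cofinite (nhds 0) :=
    tendsto_zero_iff_norm_tendsto_zero.1 hc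
  have hfin : ∀ r : ℝ, 0 < r → {y | r ≤ ‖h y - c‖}.Finite := fun r hr => by
    have h1 := hnorm.eventually (gt_mem_nhds hr)
    rw [Filter.eventually_cofinite] at h1
    simpa using h1
  have hx0 : 0 < ‖h x - c‖ := norm_pos_iff.2 (sub_ne_zero.2 hx)
  obtain ⟨z, hz, hzmax⟩ := (hfin _ hx0).toFinset.exists_max_image (fun y => ‖h y - c‖)
    ⟨x, by simp⟩
  have hzx : ‖h x - c‖ ≤ ‖h z - c‖ := by simpa using hz
  have hmax : ∀ y, ‖h y - c‖ ≤ ‖h z - c‖ := fun y => by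
    rcases le_total ‖h x - c‖ ‖h y - c‖ with h1 | h1
    · exact hzmax y (by simpa using h1)
    · exact h1.trans hzx
  -- the set where `‖h - c‖` is maximal is closed under passing to neighbours
  have hstep : ∀ y, ‖h y - c‖ = ‖h z - c‖ → ∀ y', G.Adj y y' → ‖h y' - c‖ = ‖h z - c‖ := by
    intro y hy y' hadj
    have h1 : (G.degree y : 𝕜) * (h y - c) = ∑ t ∈ G.neighborFinset y, (h t - c) := by
      rw [Finset.sum_sub_distrib, ← degree_mul_walkOp, hh y, Finset.sum_const,
        card_neighborFinset_eq_degree, nsmul_eq_mul]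
      ring
    have h2 : ∑ t ∈ G.neighborFinset y, ‖h z - c‖ ≤ ∑ t ∈ G.neighborFinset y, ‖h t - c‖ := by
      rw [Finset.sum_const, card_neighborFinset_eq_degree, nsmul_eq_mul, ← hy,
        ← RCLike.norm_natCast (K := 𝕜), ← norm_mul, h1]
      exact norm_sum_le _ _
    have h3 := (Finset.sum_eq_sum_iff_of_le fun t _ => hmax t).1
      (le_antisymm (Finset.sum_le_sum fun t _ => hmax t) h2)
    exact h3 y' (by simpa using hadj)
  have hall : ∀ y, ‖h y - c‖ = ‖h z - c‖ := fun y => by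
    have key : ∀ a b, G.Walk a b → ‖h a - c‖ = ‖h z - c‖ → ‖h b - c‖ = ‖h z - c‖ :=
      fun a b w => by
        induction w with
        | nil => exact id
        | cons hadj _ ih => exact fun ha => ih (hstep _ ha _ hadj)
    obtain ⟨w⟩ := hconn.preconnected z y
    exact key z y w rfl
  refine Set.infinite_univ ((hfin _ hx0).subset fun y _ => ?_)
  exact hzx.trans (hall y).ge

/-- If the bounded harmonic functions with gradient in `ℓ^p` are constant, then a bounded function
with gradient in `ℓ^r` is constant at infinity: it is the sum of a bounded harmonic function and of
a solution `u ∈ ℓ^p` of a Poisson equation. -/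
theorem exists_tendsto_of_bounded (hN : ∃ N : ℕ, ∀ x, G.degree x ≤ N)
    {d : ℝ} (hIS : G.HasIS d) {p r : ℝ≥0∞} (hp1 : 1 ≤ p.toReal) (hpd : p.toReal < d / 2)
    (hr1 : 1 ≤ r) (hr : r < ENNReal.ofReal (p.toReal * d / (d + 2 * p.toReal)))
    (hno : ¬ ∃ h : V → 𝕜, G.IsHarmonic h ∧ (∃ C : ℝ, ∀ x, ‖h x‖ ≤ C) ∧
        Memℓp (G.grad 𝕜 h) p ∧ ¬ ∃ c : 𝕜, ∀ x, h x = c)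
    {g : V → 𝕜} (hgb : ∃ C : ℝ, ∀ x, ‖g x‖ ≤ C) (hg : Memℓp (G.grad 𝕜 g) r) :
    ∃ c, Filter.Tendsto (fun x => g x - c) Filter.cofinite (nhds 0) := by
  obtain ⟨N, hN⟩ := hN
  have hp0 : 0 < p.toReal := by linarith
  have hd : 2 < d := by linarith
  set m := p.toReal * d / (d + 2 * p.toReal) with hm
  have hden : 0 < d + 2 * p.toReal := by linarith
  have hm1 : 1 < m := by
    have := hr1.trans_lt hr
    rwa [ENNReal.one_lt_ofReal] at this
  have hm0 : 0 < m := by linarith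
  have hmp : m ≤ p.toReal := by
    rw [hm, div_le_iff₀ hden]
    nlinarith
  have hs : 1 / p.toReal = 1 / m - 2 / d := by
    rw [hm]
    field_simp
    ring
  have hgm : Memℓp (G.grad 𝕜 g) (ENNReal.ofReal m) := hg.of_exponent_ge hr.le
  have hmR : (ENNReal.ofReal m).toReal = m := ENNReal.toReal_ofReal hm0.le
  have hgsum := (memℓp_gen_iff' (by rw [hmR]; exact hm0)).1 hgm
  rw [hmR] at hgsum
  obtain ⟨u, ⟨M, huM⟩, hu⟩ := exists_sub_walkOp_eq hN hIS hm1 (hmp.trans_lt hpd) hp0 hs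
    (sum_norm_sub_walkOp_rpow_le hIS.degree_pos hm1.le g hgsum)
  have hup : Memℓp u p := memℓp_gen' huM
  have hharm : G.IsHarmonic (g - u) := fun x => by
    rw [walkOp_sub, Pi.sub_apply]
    linear_combination hu x
  have hbdd : ∃ C : ℝ, ∀ x, ‖(g - u) x‖ ≤ C := by
    obtain ⟨C, hC⟩ := hgb
    obtain ⟨C', hC'⟩ := memℓp_infty_iff.1 (hup.of_exponent_ge le_top)
    exact ⟨C + C', fun x => (norm_sub_le _ _).trans (add_le_add (hC x) (hC' ⟨x, rfl⟩))⟩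
  have hgradp : Memℓp (G.grad 𝕜 (g - u)) p := by
    rw [map_sub]
    refine (hgm.of_exponent_ge (ENNReal.ofReal_le_of_le_toReal hmp)).sub (memℓp_grad hN hp0 hup)
  by_contra hcon
  refine hno ⟨g - u, hharm, hbdd, hgradp, fun ⟨c, hc⟩ => hcon ⟨c, ?_⟩⟩
  refine (tendsto_cofinite_zero_of_sum_rpow_le hp0 huM).congr fun x => ?_
  rw [← hc x, Pi.sub_apply]
  ring

end Harmonic

end SimpleGraph

end

theorem mainTheorem1 {𝕜 : Type*} [RCLike 𝕜] {V : Type*} (G : SimpleGraph V) [G.LocallyFinite]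
    (hconn : G.Connected) (hval : ∃ N : ℕ, ∀ x : V, G.degree x ≤ N)
    (d : ℝ) (hIS : G.HasIS d)
    (q p : ℝ≥0∞) [Fact (1 ≤ q)] [Fact (1 ≤ p)] (hqp : q ≤ p) (hpd : p < ENNReal.ofReal (d / 2)) :
    Function.Injective (G.reducedLpH1Map 𝕜 hqp) ∧
    ((¬ ∃ h : V → 𝕜, G.IsHarmonic h ∧ (∃ C : ℝ, ∀ x, ‖h x‖ ≤ C) ∧
        Memℓp (G.grad 𝕜 h) p ∧ ¬ ∃ c : 𝕜, ∀ x, h x = c) →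
      ∀ (r : ℝ≥0∞) [Fact (1 ≤ r)],
        r < ENNReal.ofReal (p.toReal * d / (d + 2 * p.toReal)) →
          Subsingleton (G.ReducedLpH1 𝕜 r)) ∧
    ((∃ h : V → 𝕜, G.IsHarmonic h ∧ Memℓp (G.grad 𝕜 h) p ∧ ¬ ∃ c : 𝕜, ∀ x, h x = c) →
      Nontrivial (G.ReducedLpH1 𝕜 p)) := by
  obtain ⟨N, hN⟩ := hval
  have := hconn.nonempty
  have := hIS.infinite
  have h1p : 1 ≤ p := Fact.out
  have hpt : p ≠ ∞ := (hpd.trans ENNReal.ofReal_lt_top).ne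
  have hpR : p.toReal < d / 2 := (ENNReal.lt_ofReal_iff_toReal_lt hpt).1 hpd
  have hp1 : 1 ≤ p.toReal := by
    rw [← ENNReal.toReal_one]
    exact ENNReal.toReal_mono hpt h1p
  refine ⟨?_, ?_, ?_⟩
  · rw [← LinearMap.ker_eq_bot, LinearMap.ker_eq_bot']
    intro ξ hξ
    obtain ⟨ω, rfl⟩ := Submodule.Quotient.mk_surjective _ ξ
    obtain ⟨g, hg⟩ := ω.2
    rw [Submodule.Quotient.mk_eq_zero]
    have h1 : G.lpGradientsInclusion 𝕜 hqp ω ∈ G.closureGradOfLp 𝕜 p :=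
      (Submodule.Quotient.mk_eq_zero _).1 hξ
    exact (SimpleGraph.mem_closure_gradOfLp_iff hconn hN hIS (hqp.trans_lt hpd) hg).2
      ((SimpleGraph.mem_closure_gradOfLp_iff hconn hN hIS hpd
        (ω := (G.lpGradientsInclusion 𝕜 hqp ω : G.EdgeLp 𝕜 p)) hg).1 h1)
  · intro hno r _ hr
    have hr1 : 1 ≤ r := Fact.out
    have hrp : r ≤ p := by
      refine hr.le.trans (ENNReal.ofReal_le_of_le_toReal ?_)
      rw [div_le_iff₀ (by linarith)]
      nlinarith
    have hr0 : 0 < r.toReal := ENNReal.toReal_pos (zero_lt_one.trans_le hr1).ne'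
      (ne_top_of_le_ne_top hpt hrp)
    rw [Submodule.Quotient.subsingleton_iff, eq_top_iff]
    rintro ω -
    obtain ⟨g, hg⟩ := ω.2
    -- it suffices to treat the truncations of `g`, which are bounded
    refine SimpleGraph.mem_of_isClosed_of_grad_dominated hr0 (isClosed_closure)
      (S := closure (G.gradOfLp 𝕜 r : Set (G.EdgeLp 𝕜 r))) hg (l := Filter.atTop)
      (u := fun (n : ℕ) x => SimpleGraph.clamp (n : ℝ) (g x)) (C := 2) (fun x => ?_)
      (fun n x y => SimpleGraph.norm_clamp_sub_clamp_le _ _ _) fun n η hη => ?_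
    · refine tendsto_const_nhds.congr' ?_
      filter_upwards [Filter.eventually_ge_atTop ⌈‖g x‖⌉₊] with n hn
      exact (SimpleGraph.clamp_of_norm_le (Nat.ceil_le.1 hn)).symm
    · refine (SimpleGraph.mem_closure_gradOfLp_iff hconn hN hIS (hrp.trans_lt hpd) hη).2 ?_
      refine SimpleGraph.exists_tendsto_of_bounded ⟨N, hN⟩ hIS hp1 hpR hr1 hr hno
        ⟨2 * n, fun x => SimpleGraph.norm_clamp_le (Nat.cast_nonneg n) _⟩ ?_
      convert! lp.memℓp η using 1
      exact (funext hη).symm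
  · rintro ⟨h, hh, hhp, hne⟩
    by_contra htriv
    rw [not_nontrivial_iff_subsingleton, Submodule.Quotient.subsingleton_iff] at htriv
    have h1 : (⟨⟨_, hhp⟩, h, fun _ => rfl⟩ : G.lpGradients 𝕜 p) ∈ G.closureGradOfLp 𝕜 p :=
      htriv ▸ Submodule.mem_top
    obtain ⟨c, hc⟩ := (SimpleGraph.mem_closure_gradOfLp_iff hconn hN hIS hpd
      (ω := (⟨_, hhp⟩ : G.EdgeLp 𝕜 p)) (g := h) fun _ => rfl).1 h1
    exact hne ⟨c, hh.eq_of_tendsto_cofinite hconn hc⟩
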